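/- Let $n\ge 1$. An algebraic variety in $\mathbb C^n$ is an irreducible (in particular nonempty) common zero set of a set of polynomials in $\mathbb C[z_1,\dots,z_n]$. For a compact set $X\subset\mathbb C^n$, let $\mathcal R(X)$ be the algebra of quotients $p/q$ of polynomials such that $q$ has no zero in $X$; a boundary of $X$ is a closed subset $\Delta\subseteq X$ such that every $f\in\mathcal R(X)$ attains its maximum modulus over $X$ at a point of $\Delta$, and the distinguished boundary $bX$ is the intersection of all boundaries of $X$ (the Shilov boundary of $\mathcal R(X)$). A distinguished variety in a bounded domain $G\subset\mathbb C^n$ is a nonempty set of the form $\Omega=G\cap W$, where $W\subset\mathbb C^n$ is an algebraic variety with $\dim W>0$ and \[ (W\cap\overline G)\cap\partial\overline G=(W\cap\overline G)\cap b\overline G . \] Let $\mathbb D^n=\{z\in\mathbb C^n:|z_i|<1,\ 1\le i\le n\}$ be the open unit polydisc, let $\pi_n:\mathbb C^n\to\mathbb C^n$ be the symmetrization map $\pi_n(z)=(s_1(z),\dots,s_n(z))$, where \[ s_k(z)=\sum_{1\le i_1<\dots<i_k\le n}z_{i_1}\cdots z_{i_k}, \] and let $\mathbb G_n=\pi_n(\mathbb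 D^n)$ be the symmetrized polydisc. Let $\Lambda\subset\mathbb G_n$. Then $\Lambda$ is a distinguished variety in $\mathbb G_n$ if and only if $\Lambda=\pi_n(\Omega)$ for some distinguished variety $\Omega$ in $\mathbb D^n$. -/

import Mathlib

/-- The zero set `Z(S) ⊆ ℂⁿ` of a set `S` of complex polynomials in `n` variables. -/
def zeroSet {n : ℕ} (S : Set (MvPolynomial (Fin n) ℂ)) : Set (Fin n → ℂ) :=
  {x | ∀ f ∈ S, MvPolynomial.eval x f = 0}

/-- Affine algebraic sets in `ℂⁿ`. -/
def IsAlgebraicSet {n : ℕ} (W : Set (Fin n → ℂ)) : Prop :=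
  ∃ S : Set (MvPolynomial (Fin n) ℂ), W = zeroSet S

/-- Affine algebraic varieties: irreducible algebraic sets, that is, nonempty algebraic sets that
are not the union of two proper algebraic subsets. -/
def IsAlgebraicVariety {n : ℕ} (W : Set (Fin n → ℂ)) : Prop :=
  IsAlgebraicSet W ∧ W.Nonempty ∧
    ∀ A B : Set (Fin n → ℂ), IsAlgebraicSet A → IsAlgebraicSet B → W = A ∪ B → W = A ∨ W = B

/-- The complex dimension of an algebraic set: the Krull dimension of its coordinate ring
`ℂ[z₁, …, zₙ] / I(W)`. -/
noncomputable def algebraicDim {n : ℕ} (W : Set (Fin n → ℂ)) : WithBot ℕ∞ :=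
  ringKrullDim
    (MvPolynomial (Fin n) ℂ ⧸ (MvPolynomial.vanishingIdeal ℂ W : Ideal (MvPolynomial (Fin n) ℂ)))

/-- `Δ` is a boundary of the compact set `X ⊆ ℂⁿ` for the algebra of all quotients `p / q` of
polynomials with `q` zero-free on `X`: a closed subset of `X` on which every function of the algebra
attains its maximum modulus over `X`. -/
def IsRationalBoundary {n : ℕ} (X Δ : Set (Fin n → ℂ)) : Prop :=
  Δ ⊆ X ∧ IsClosed Δ ∧
    ∀ p q : MvPolynomial (Fin n) ℂ, (∀ x ∈ X, MvPolynomial.eval x q ≠ 0) →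
      ∃ x ∈ Δ, ∀ y ∈ X,
        ‖MvPolynomial.eval y p / MvPolynomial.eval y q‖ ≤
          ‖MvPolynomial.eval x p / MvPolynomial.eval x q‖

/-- The distinguished (Shilov) boundary `bX` of a compact set `X ⊆ ℂⁿ`: the intersection of all
boundaries of `X` for the algebra of rational functions with no poles on `X`. -/
def distinguishedBoundary {n : ℕ} (X : Set (Fin n → ℂ)) : Set (Fin n → ℂ) :=
  ⋂₀ {Δ | IsRationalBoundary X Δ}

/-- `Ω` is a distinguished variety in the domain `G ⊆ ℂⁿ`: it is the nonempty intersection of `G`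
with an irreducible algebraic set `W` of positive dimension such that `W` meets the topological
boundary of `G` only in the distinguished boundary of the closure of `G`. -/
def IsDistinguishedVariety {n : ℕ} (G Ω : Set (Fin n → ℂ)) : Prop :=
  ∃ W : Set (Fin n → ℂ), IsAlgebraicVariety W ∧ 0 < algebraicDim W ∧
    Ω = G ∩ W ∧ Ω.Nonempty ∧
    (W ∩ closure G) ∩ frontier (closure G) = (W ∩ closure G) ∩ distinguishedBoundary (closure G)

/-- The open unit polydisc `𝔻ⁿ`. -/
def polydisc (n : ℕ) : Set (Fin n → ℂ) :=
  {z | ∀ i, ‖z i‖ < 1}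

/-- The symmetrization map `πₙ(z) = (s₁(z), …, sₙ(z))`, with `sₖ` the `k`-th elementary symmetric
polynomial; the coordinate with index `i : Fin n` is `s_{i+1}`. -/
noncomputable def symmetrization (n : ℕ) (z : Fin n → ℂ) : Fin n → ℂ :=
  fun i => MvPolynomial.eval z (MvPolynomial.esymm (Fin n) ℂ ((i : ℕ) + 1))

/-- The symmetrized polydisc `𝔾ₙ = πₙ(𝔻ⁿ)`. -/
noncomputable def symmetrizedPolydisc (n : ℕ) : Set (Fin n → ℂ) :=
  symmetrization n '' polydisc n

/-! The map `πₙ` is finite and surjective: `p ↦ p ∘ πₙ` embeds the polynomial ring onto the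
symmetric polynomials, over which every polynomial is integral. Going up then shows that `πₙ` sends
varieties to varieties and that every variety is such an image (`symmetrization_image_zeroLocus`,
`IsAlgebraicVariety.exists_image_symmetrization_eq`). Integrality also preserves maximality of
primes in both directions, hence positivity of dimension.

Points with the same image have the same coordinates as sets, so the open polydisc, the closed
polydisc and the torus are saturated for `πₙ`. The boundary condition therefore transfers pointwise
(`boundary_condition_image_iff`), once the distinguished boundaries are known to be the torus and
its image. The image case is the analytic core: symmetrized powers of a peak polynomial
(`IsRationalBoundary.image_unitTorus_subset`). -/

/-- The algebra endomorphism `p ↦ p ∘ πₙ` of `ℂ[z₁, …, zₙ]`. -/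
noncomputable def symmetrizationHom (n : ℕ) :
    MvPolynomial (Fin n) ℂ →ₐ[ℂ] MvPolynomial (Fin n) ℂ :=
  MvPolynomial.aeval fun i => MvPolynomial.esymm (Fin n) ℂ ((i : ℕ) + 1)

theorem eval_symmetrizationHom {n : ℕ} (z : Fin n → ℂ) (p : MvPolynomial (Fin n) ℂ) :
    MvPolynomial.eval z (symmetrizationHom n p) = MvPolynomial.eval (symmetrization n z) p := by
  induction p using MvPolynomial.induction_on with
  | C r => simp [symmetrizationHom]
  | add p q hp hq => simp [hp, hq]
  | mul_X p i hp =>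
    rw [map_mul, map_mul, map_mul, hp, MvPolynomial.eval_X]
    simp [symmetrizationHom, symmetrization]

theorem symmetrizationHom_injective (n : ℕ) : Function.Injective (symmetrizationHom n) := by
  intro p q h
  apply MvPolynomial.esymmAlgHom_fin_injective ℂ (le_refl n)
  apply Subtype.ext
  rw [MvPolynomial.esymmAlgHom_apply, MvPolynomial.esymmAlgHom_apply]
  exact h

theorem exists_symmetrizationHom_eq {n : ℕ} {p : MvPolynomial (Fin n) ℂ} (hp : p.IsSymmetric) :
    ∃ q, symmetrizationHom n q = p := by
  obtain ⟨q, hq⟩ := MvPolynomial.esymmAlgHom_fin_surjective ℂ (le_refl n) ⟨p, hp⟩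
  refine ⟨q, ?_⟩
  have := congrArg Subtype.val hq
  rwa [MvPolynomial.esymmAlgHom_apply] at this

/-! ### Roots and coefficients: fibres, properness and integrality of `πₙ` -/

theorem prod_add_eq_sum_symmetrization {n : ℕ} (z : Fin n → ℂ) (x : ℂ) :
    ∏ i, (x + z i) = x ^ n + ∑ i : Fin n, symmetrization n z i * x ^ (n - (i + 1)) := by
  have h := congrArg (Polynomial.eval x)
    (Multiset.prod_X_add_C_eq_sum_esymm ((Finset.univ : Finset (Fin n)).val.map z))
  rw [Polynomial.eval_multiset_prod, Polynomial.eval_finsetSum, Finset.sum_range_succ'] at h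
  simp only [Multiset.map_map, Function.comp_def, Polynomial.eval_add, Polynomial.eval_X,
    Polynomial.eval_C, Multiset.card_map, Finset.card_val, Finset.card_univ, Fintype.card_fin,
    Polynomial.eval_mul, Polynomial.eval_pow] at h
  have h0 : ((Finset.univ : Finset (Fin n)).val.map z).esymm 0 = 1 := by simp [Multiset.esymm]
  rw [h0, one_mul, Nat.sub_zero] at h
  rw [Finset.prod, h, ← Fin.sum_univ_eq_sum_range
    (fun j => ((Finset.univ : Finset (Fin n)).val.map z).esymm (j + 1) * x ^ (n - (j + 1)))]
  have hs (i : Fin n) : symmetrization n z i =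
      ((Finset.univ : Finset (Fin n)).val.map z).esymm (i + 1) := by
    rw [symmetrization, ← MvPolynomial.aeval_esymm_eq_multiset_esymm (Fin n) ℂ]
    rfl
  simp only [hs]
  rw [add_comm]

theorem exists_eq_of_symmetrization_eq {n : ℕ} {z w : Fin n → ℂ}
    (h : symmetrization n z = symmetrization n w) (j : Fin n) : ∃ i, w j = z i := by
  have hz := prod_add_eq_sum_symmetrization z (-w j)
  have hw : ∏ i, (-w j + w i) = 0 := Finset.prod_eq_zero (Finset.mem_univ j) (by simp)
  rw [h, ← prod_add_eq_sum_symmetrization, hw, Finset.prod_eq_zero_iff] at hz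
  obtain ⟨i, -, hi⟩ := hz
  exact ⟨i, by linear_combination -hi⟩

/-- Cauchy's bound for the roots of a monic polynomial in terms of its coefficients; it makes `πₙ`
proper. -/
theorem norm_le_of_symmetrization {n : ℕ} (z : Fin n → ℂ) (j : Fin n) :
    ‖z j‖ ≤ 1 + ∑ i, ‖symmetrization n z i‖ := by
  have hs : 0 ≤ ∑ i, ‖symmetrization n z i‖ := Finset.sum_nonneg fun _ _ => norm_nonneg _
  rcases le_total ‖z j‖ 1 with h1 | h1
  · linarith
  have hz := prod_add_eq_sum_symmetrization z (-z j)
  rw [Finset.prod_eq_zero (Finset.mem_univ j) (by simp)] at hz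
  have hpow : ‖z j‖ ^ n = ‖∑ i : Fin n, symmetrization n z i * (-z j) ^ (n - (i + 1))‖ := by
    rw [← norm_neg (z j), ← norm_pow, ← norm_neg ((-z j) ^ n)]
    congr 1
    linear_combination hz
  have hle : ‖z j‖ ^ n ≤ (∑ i, ‖symmetrization n z i‖) * ‖z j‖ ^ (n - 1) := by
    rw [hpow, Finset.sum_mul]
    refine (norm_sum_le _ _).trans (Finset.sum_le_sum fun i _ => ?_)
    rw [norm_mul, norm_pow, norm_neg]
    -- The exponents `n - (i + 1)` are at most `n - 1`, and `‖z j‖ ≥ 1` here.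
    exact mul_le_mul_of_nonneg_left (pow_le_pow_right₀ h1 (by omega)) (norm_nonneg _)
  have hn : n = n - 1 + 1 := by have := j.pos; omega
  have hpos : 0 < ‖z j‖ ^ (n - 1) := by positivity
  rw [show ‖z j‖ ^ n = ‖z j‖ * ‖z j‖ ^ (n - 1) by rw [← pow_succ', ← hn]] at hle
  linarith [le_of_mul_le_mul_right hle hpos]

theorem symmetrization_comp_perm {n : ℕ} (z : Fin n → ℂ) (σ : Equiv.Perm (Fin n)) :
    symmetrization n (z ∘ σ) = symmetrization n z := by
  funext i
  rw [symmetrization, symmetrization, ← MvPolynomial.eval_rename,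
    MvPolynomial.esymm_isSymmetric]

theorem continuous_symmetrization (n : ℕ) : Continuous (symmetrization n) :=
  continuous_pi fun _ => MvPolynomial.continuous_eval _

theorem isProperMap_symmetrization (n : ℕ) : IsProperMap (symmetrization n) := by
  refine isProperMap_iff_isCompact_preimage.mpr ⟨continuous_symmetrization n, fun K hK => ?_⟩
  refine Metric.isCompact_of_isClosed_isBounded
    (hK.isClosed.preimage (continuous_symmetrization n)) ?_
  obtain ⟨C, hC⟩ := hK.isBounded.exists_norm_le
  refine isBounded_iff_forall_norm_le.mpr ⟨1 + ∑ _ : Fin n, |C|, fun z hz => ?_⟩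
  refine (pi_norm_le_iff_of_nonneg (by positivity)).mpr fun j => ?_
  refine (norm_le_of_symmetrization z j).trans ?_
  gcongr with i
  exact ((norm_le_pi_norm _ i).trans (hC _ hz)).trans (le_abs_self C)

/-- Each `-X i` is a root of `∏ (T + X j)`, whose coefficients are symmetric and so lift through the
homomorphism. -/
theorem symmetrizationHom_isIntegral (n : ℕ) : (symmetrizationHom n).toRingHom.IsIntegral := by
  have hX (i : Fin n) : (symmetrizationHom n).toRingHom.IsIntegralElem (MvPolynomial.X i) := by
    let f : Polynomial (MvPolynomial (Fin n) ℂ) :=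
      ∏ j, (Polynomial.X + Polynomial.C (MvPolynomial.X j))
    have hf : f.Monic := Polynomial.monic_prod_of_monic _ _ fun j _ => Polynomial.monic_X_add_C _
    have hdeg : f.natDegree = n := by
      rw [Polynomial.natDegree_prod_of_monic _ _ fun j _ => Polynomial.monic_X_add_C _]
      simp
    have hl : f ∈ Polynomial.lifts (symmetrizationHom n).toRingHom := by
      rw [Polynomial.lifts_iff_coeff_lifts]
      intro k
      rcases le_or_gt k n with hk | hk
      · rw [MvPolynomial.prod_X_add_C_coeff _ _ k (by simpa using hk), Fintype.card_fin]
        obtain ⟨q, hq⟩ := exists_symmetrizationHom_eq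
          (MvPolynomial.esymm_isSymmetric (Fin n) ℂ (n - k))
        exact ⟨q, hq⟩
      · rw [Polynomial.coeff_eq_zero_of_natDegree_lt (hdeg.trans_lt hk)]
        exact ⟨0, map_zero _⟩
    obtain ⟨g, hg, -, hgm⟩ := Polynomial.lifts_and_natDegree_eq_and_monic hl hf
    have hneg : (symmetrizationHom n).toRingHom.IsIntegralElem (-MvPolynomial.X i) := by
      refine ⟨g, hgm, ?_⟩
      rw [← Polynomial.eval_map, hg, Polynomial.eval_prod]
      exact Finset.prod_eq_zero (Finset.mem_univ i) (by simp)
    simpa using hneg.neg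
  intro p
  induction p using MvPolynomial.induction_on with
  | C r =>
    have : MvPolynomial.C r = (symmetrizationHom n).toRingHom (MvPolynomial.C r) := by
      simp [symmetrizationHom]
    rw [this]
    exact RingHom.isIntegralElem_map _
  | add p q hp hq => exact hp.add _ hq
  | mul_X p i hp => exact hp.mul _ (hX i)

/-! ### Varieties, prime ideals and going up -/

theorem isAlgebraicSet_iff_exists_zeroLocus {n : ℕ} {W : Set (Fin n → ℂ)} :
    IsAlgebraicSet W ↔ ∃ I : Ideal (MvPolynomial (Fin n) ℂ), W = MvPolynomial.zeroLocus ℂ I := by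
  constructor
  · rintro ⟨S, rfl⟩
    exact ⟨Ideal.span S, (MvPolynomial.zeroLocus_span S).symm⟩
  · rintro ⟨I, rfl⟩
    exact ⟨(I : Set (MvPolynomial (Fin n) ℂ)), rfl⟩

theorem IsAlgebraicSet.zeroLocus_vanishingIdeal {n : ℕ} {W : Set (Fin n → ℂ)}
    (hW : IsAlgebraicSet W) :
    MvPolynomial.zeroLocus ℂ (MvPolynomial.vanishingIdeal ℂ W) = W := by
  obtain ⟨I, rfl⟩ := isAlgebraicSet_iff_exists_zeroLocus.mp hW
  exact MvPolynomial.zeroLocus_vanishingIdeal_galoisConnection.l_u_l_eq_l I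

/-- If `f * g` vanishes on `W`, adjoining `f` or `g` to the equations covers `W` by two algebraic
sets. -/
theorem IsAlgebraicVariety.isPrime_vanishingIdeal {n : ℕ} {W : Set (Fin n → ℂ)}
    (hW : IsAlgebraicVariety W) : (MvPolynomial.vanishingIdeal ℂ W).IsPrime := by
  obtain ⟨⟨S, hS⟩, ⟨w, hw⟩, hirr⟩ := hW
  refine ⟨fun h => ?_, fun {f g} hfg => ?_⟩
  · have h1 : (1 : MvPolynomial (Fin n) ℂ) ∈ MvPolynomial.vanishingIdeal ℂ W := h ▸ trivial
    simpa using h1 w hw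
  · have hmem (h : MvPolynomial (Fin n) ℂ) (hh : W = zeroSet (insert h S)) :
        h ∈ MvPolynomial.vanishingIdeal ℂ W :=
      fun x hx => (hh ▸ hx : x ∈ zeroSet (insert h S)) h (Set.mem_insert _ _)
    refine (hirr (zeroSet (insert f S)) (zeroSet (insert g S)) ⟨_, rfl⟩ ⟨_, rfl⟩ ?_).imp
      (hmem f) (hmem g)
    ext x
    constructor
    · intro hx
      have hxS : x ∈ zeroSet S := hS ▸ hx
      have h0 : MvPolynomial.eval x f * MvPolynomial.eval x g = 0 := by
        rw [← map_mul]; exact hfg x hx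
      refine (mul_eq_zero.mp h0).imp (fun h => ?_) (fun h => ?_) <;>
      · rintro p (rfl | hp)
        exacts [h, hxS p hp]
    · rintro (hx | hx) <;>
      · rw [hS]
        exact fun p hp => hx p (Set.mem_insert_of_mem _ hp)

theorem isAlgebraicVariety_zeroLocus {n : ℕ} (Q : Ideal (MvPolynomial (Fin n) ℂ)) [hQ : Q.IsPrime] :
    IsAlgebraicVariety (MvPolynomial.zeroLocus ℂ Q) := by
  have hI : MvPolynomial.vanishingIdeal ℂ (MvPolynomial.zeroLocus ℂ Q) = Q :=
    MvPolynomial.IsPrime.vanishingIdeal_zeroLocus Q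
  refine ⟨isAlgebraicSet_iff_exists_zeroLocus.mpr ⟨Q, rfl⟩, ?_, ?_⟩
  · rw [Set.nonempty_iff_ne_empty]
    intro h
    rw [h, MvPolynomial.vanishingIdeal_empty] at hI
    exact hQ.ne_top hI.symm
  · rintro A B ⟨S, rfl⟩ ⟨T, rfl⟩ hAB
    have hsub (S : Set (MvPolynomial (Fin n) ℂ)) (hS : S ⊆ Q) :
        MvPolynomial.zeroLocus ℂ Q ⊆ zeroSet S := fun x hx p hp => hx p (hS hp)
    by_contra! hne
    have hex (S : Set (MvPolynomial (Fin n) ℂ)) (h₁ : MvPolynomial.zeroLocus ℂ Q ≠ zeroSet S)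
        (h₂ : zeroSet S ⊆ MvPolynomial.zeroLocus ℂ Q) : ∃ f ∈ S, f ∉ Q := by
      by_contra! h
      exact h₁ ((hsub S h).antisymm h₂)
    obtain ⟨f, hfS, hf⟩ := hex S hne.1 (hAB ▸ Set.subset_union_left)
    obtain ⟨g, hgT, hg⟩ := hex T hne.2 (hAB ▸ Set.subset_union_right)
    have hfg : f * g ∈ MvPolynomial.vanishingIdeal ℂ (MvPolynomial.zeroLocus ℂ Q) := by
      intro x hx
      rw [hAB] at hx
      rw [map_mul]
      rcases hx with hx | hx
      · exact mul_eq_zero_of_left (hx f hfS) _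
      · exact mul_eq_zero_of_right _ (hx g hgT)
    rw [hI] at hfg
    exact (hQ.mem_or_mem hfg).elim hf hg

theorem ringKrullDim_quotient_pos_iff {R : Type*} [CommRing R] (P : Ideal R) [hP : P.IsPrime] :
    0 < ringKrullDim (R ⧸ P) ↔ ¬ P.IsMaximal := by
  rw [← not_iff_not, not_not, not_lt]
  constructor
  · intro h
    have : Ring.KrullDimLE 0 (R ⧸ P) := Ring.krullDimLE_iff.mpr (by exact_mod_cast h)
    exact Ideal.Quotient.maximal_of_isField _ Ring.KrullDimLE.isField_of_isDomain
  · intro h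
    exact (ringKrullDim_eq_zero_of_isField
      ((Ideal.Quotient.maximal_ideal_iff_isField_quotient P).mp h)).le

/-- Going up, for an integral ring homomorphism. -/
theorem RingHom.IsIntegral.exists_isPrime_comap_eq {R S : Type*} [CommRing R] [CommRing S]
    {f : R →+* S} (hf : f.IsIntegral) (P : Ideal R) [P.IsPrime] (I : Ideal S)
    (hIP : I.comap f ≤ P) : ∃ Q ≥ I, Q.IsPrime ∧ Q.comap f = P := by
  algebraize [f]
  exact Ideal.exists_ideal_over_prime_of_isIntegral P I hIP

theorem isMaximal_comap_symmetrizationHom_iff {n : ℕ} (Q : Ideal (MvPolynomial (Fin n) ℂ))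
    [hQ : Q.IsPrime] : (Q.comap (symmetrizationHom n).toRingHom).IsMaximal ↔ Q.IsMaximal :=
  ⟨Ideal.isMaximal_of_isIntegral_of_isMaximal_comap' _ (symmetrizationHom_isIntegral n) Q,
    fun _ => Ideal.isMaximal_comap_of_isIntegral_of_isMaximal' _ (symmetrizationHom_isIntegral n) Q⟩

/-- `πₙ` is a finite map: the image of the zero set of a prime ideal is the zero set of its
contraction. -/
theorem symmetrization_image_zeroLocus {n : ℕ} (Q : Ideal (MvPolynomial (Fin n) ℂ))
    [Q.IsPrime] :
    symmetrization n '' MvPolynomial.zeroLocus ℂ Q =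
      MvPolynomial.zeroLocus ℂ (Q.comap (symmetrizationHom n).toRingHom) := by
  ext y
  constructor
  · rintro ⟨z, hz, rfl⟩ p hp
    have := hz _ hp
    rw [MvPolynomial.aeval_eq_eval] at this ⊢
    exact (eval_symmetrizationHom z p).symm.trans this
  · intro hy
    have hle : Q.comap (symmetrizationHom n).toRingHom ≤ MvPolynomial.vanishingIdeal ℂ {y} := by
      intro p hp
      rw [MvPolynomial.mem_vanishingIdeal_singleton_iff]
      exact hy p hp
    -- Going up from `Q` to the maximal ideal of `y`: by the Nullstellensatz, `M` is the ideal of a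
    -- point `z` of the zero locus lying over `y`.
    obtain ⟨M, hQM, hM, hMy⟩ :=
      (symmetrizationHom_isIntegral n).exists_isPrime_comap_eq _ Q hle
    have hmax : M.IsMaximal := by
      rw [← isMaximal_comap_symmetrizationHom_iff, hMy]
      exact MvPolynomial.isMaximal_iff_eq_vanishingIdeal_singleton.mpr ⟨y, rfl⟩
    obtain ⟨z, rfl⟩ := MvPolynomial.isMaximal_iff_eq_vanishingIdeal_singleton.mp hmax
    refine ⟨z, fun p hp => hQM hp z rfl, funext fun i => ?_⟩
    have hi : MvPolynomial.X i - MvPolynomial.C (y i) ∈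
        MvPolynomial.vanishingIdeal ℂ ({y} : Set (Fin n → ℂ)) := by
      rw [MvPolynomial.mem_vanishingIdeal_singleton_iff]
      simp
    rw [← hMy, Ideal.mem_comap, MvPolynomial.mem_vanishingIdeal_singleton_iff,
      MvPolynomial.aeval_eq_eval] at hi
    have h1 := (eval_symmetrizationHom z _).symm.trans hi
    simpa [sub_eq_zero] using h1

theorem comap_symmetrizationHom_bot (n : ℕ) :
    Ideal.comap (symmetrizationHom n).toRingHom ⊥ = ⊥ := by
  rw [← RingHom.ker_eq_comap_bot]
  exact (RingHom.injective_iff_ker_eq_bot _).mp (symmetrizationHom_injective n)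

theorem symmetrization_surjective (n : ℕ) : Function.Surjective (symmetrization n) := by
  have h := symmetrization_image_zeroLocus (n := n) ⊥
  rw [comap_symmetrizationHom_bot, MvPolynomial.zeroLocus_bot] at h
  exact Set.range_eq_univ.mp (by rw [← Set.image_univ]; exact h)

theorem algebraicDim_zeroLocus_pos_iff {n : ℕ} (Q : Ideal (MvPolynomial (Fin n) ℂ))
    [hQ : Q.IsPrime] : 0 < algebraicDim (MvPolynomial.zeroLocus ℂ Q) ↔ ¬ Q.IsMaximal := by
  rw [algebraicDim, MvPolynomial.IsPrime.vanishingIdeal_zeroLocus Q, ringKrullDim_quotient_pos_iff]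

theorem IsAlgebraicVariety.image_symmetrization {n : ℕ} {W : Set (Fin n → ℂ)}
    (hW : IsAlgebraicVariety W) (hdim : 0 < algebraicDim W) :
    IsAlgebraicVariety (symmetrization n '' W) ∧ 0 < algebraicDim (symmetrization n '' W) := by
  have := hW.isPrime_vanishingIdeal
  rw [← hW.1.zeroLocus_vanishingIdeal, algebraicDim_zeroLocus_pos_iff] at hdim
  rw [← hW.1.zeroLocus_vanishingIdeal, symmetrization_image_zeroLocus,
    algebraicDim_zeroLocus_pos_iff, isMaximal_comap_symmetrizationHom_iff]
  exact ⟨isAlgebraicVariety_zeroLocus _, hdim⟩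

/-- The full preimage of `V` may be reducible; a prime lying over the ideal of `V` gives an
irreducible set that already maps onto `V`. -/
theorem IsAlgebraicVariety.exists_image_symmetrization_eq {n : ℕ} {V : Set (Fin n → ℂ)}
    (hV : IsAlgebraicVariety V) (hdim : 0 < algebraicDim V) :
    ∃ W, IsAlgebraicVariety W ∧ 0 < algebraicDim W ∧ symmetrization n '' W = V := by
  have := hV.isPrime_vanishingIdeal
  obtain ⟨Q, -, hQ, hQV⟩ := (symmetrizationHom_isIntegral n).exists_isPrime_comap_eq
    (MvPolynomial.vanishingIdeal ℂ V) ⊥ (by rw [comap_symmetrizationHom_bot]; exact bot_le)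
  rw [← hV.1.zeroLocus_vanishingIdeal, algebraicDim_zeroLocus_pos_iff, ← hQV,
    isMaximal_comap_symmetrizationHom_iff] at hdim
  refine ⟨MvPolynomial.zeroLocus ℂ Q, isAlgebraicVariety_zeroLocus Q,
    (algebraicDim_zeroLocus_pos_iff Q).mpr hdim, ?_⟩
  rw [symmetrization_image_zeroLocus, hQV, hV.1.zeroLocus_vanishingIdeal]

/-! ### Topology of the polydisc and its image -/

/-- The closed unit polydisc. -/
def closedPolydisc (n : ℕ) : Set (Fin n → ℂ) :=
  {z | ∀ i, ‖z i‖ ≤ 1}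

/-- The unit torus `𝕋ⁿ`. -/
def unitTorus (n : ℕ) : Set (Fin n → ℂ) :=
  {z | ∀ i, ‖z i‖ = 1}

theorem polydisc_eq_pi (n : ℕ) :
    polydisc n = Set.univ.pi fun _ => Metric.ball (0 : ℂ) 1 := by
  ext z; simp [polydisc]

theorem closedPolydisc_eq_pi (n : ℕ) :
    closedPolydisc n = Set.univ.pi fun _ => Metric.closedBall (0 : ℂ) 1 := by
  ext z; simp [closedPolydisc]

theorem unitTorus_eq_pi (n : ℕ) :
    unitTorus n = Set.univ.pi fun _ => Metric.sphere (0 : ℂ) 1 := by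
  ext z; simp [unitTorus]

theorem closure_polydisc (n : ℕ) : closure (polydisc n) = closedPolydisc n := by
  rw [polydisc_eq_pi, closure_pi_set, closedPolydisc_eq_pi, closure_ball _ one_ne_zero]

theorem interior_closedPolydisc (n : ℕ) : interior (closedPolydisc n) = polydisc n := by
  rw [closedPolydisc_eq_pi, interior_pi_set Set.finite_univ, polydisc_eq_pi,
    interior_closedBall _ one_ne_zero]

theorem isOpen_polydisc (n : ℕ) : IsOpen (polydisc n) :=
  interior_closedPolydisc n ▸ isOpen_interior

theorem isCompact_closedPolydisc (n : ℕ) : IsCompact (closedPolydisc n) :=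
  closedPolydisc_eq_pi n ▸ isCompact_univ_pi fun _ => isCompact_closedBall _ _

theorem isCompact_unitTorus (n : ℕ) : IsCompact (unitTorus n) :=
  unitTorus_eq_pi n ▸ isCompact_univ_pi fun _ => isCompact_sphere _ _

theorem unitTorus_subset_closedPolydisc (n : ℕ) : unitTorus n ⊆ closedPolydisc n :=
  fun _ hz i => (hz i).le

theorem unitTorus_nonempty (n : ℕ) : (unitTorus n).Nonempty :=
  ⟨fun _ => 1, fun _ => norm_one⟩

theorem forall_of_symmetrization_eq {n : ℕ} {z w : Fin n → ℂ} {P : ℂ → Prop}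
    (h : symmetrization n z = symmetrization n w)
    (hz : ∀ i, P (z i)) (j : Fin n) : P (w j) := by
  obtain ⟨i, hi⟩ := exists_eq_of_symmetrization_eq h j
  exact hi ▸ hz i

theorem symmetrization_mem_image_polydisc_iff {n : ℕ} {z : Fin n → ℂ} :
    symmetrization n z ∈ symmetrizedPolydisc n ↔ z ∈ polydisc n :=
  ⟨fun ⟨_, hw, h⟩ => forall_of_symmetrization_eq (P := fun a => ‖a‖ < 1) h hw,
    Set.mem_image_of_mem _⟩

theorem symmetrization_mem_image_closedPolydisc_iff {n : ℕ} {z : Fin n → ℂ} :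
    symmetrization n z ∈ symmetrization n '' closedPolydisc n ↔ z ∈ closedPolydisc n :=
  ⟨fun ⟨_, hw, h⟩ => forall_of_symmetrization_eq (P := fun a => ‖a‖ ≤ 1) h hw,
    Set.mem_image_of_mem _⟩

theorem symmetrization_mem_image_unitTorus_iff {n : ℕ} {z : Fin n → ℂ} :
    symmetrization n z ∈ symmetrization n '' unitTorus n ↔ z ∈ unitTorus n :=
  ⟨fun ⟨_, hw, h⟩ => forall_of_symmetrization_eq (P := fun a => ‖a‖ = 1) h hw,
    Set.mem_image_of_mem _⟩

theorem closure_symmetrizedPolydisc (n : ℕ) :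
    closure (symmetrizedPolydisc n) = symmetrization n '' closedPolydisc n := by
  rw [symmetrizedPolydisc, (isProperMap_symmetrization n).isClosedMap.closure_image_eq_of_continuous
    (continuous_symmetrization n), closure_polydisc]

/-- By saturation and surjectivity the complement is the image of a closed set under a closed map.
-/
theorem isOpen_symmetrizedPolydisc (n : ℕ) : IsOpen (symmetrizedPolydisc n) := by
  have h : (symmetrizedPolydisc n)ᶜ = symmetrization n '' (polydisc n)ᶜ := by
    ext y
    obtain ⟨z, rfl⟩ := symmetrization_surjective n y
    rw [Set.mem_compl_iff, symmetrization_mem_image_polydisc_iff]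
    refine ⟨fun hz => ⟨z, hz, rfl⟩, ?_⟩
    rintro ⟨w, hw, hwz⟩ hz
    exact hw (symmetrization_mem_image_polydisc_iff.mp
      (hwz ▸ symmetrization_mem_image_polydisc_iff.mpr hz))
  rw [← isClosed_compl_iff, h]
  exact (isProperMap_symmetrization n).isClosedMap _ (isOpen_polydisc n).isClosed_compl

theorem interior_image_closedPolydisc (n : ℕ) :
    interior (symmetrization n '' closedPolydisc n) = symmetrizedPolydisc n := by
  apply Set.Subset.antisymm
  · intro y hy
    obtain ⟨z, rfl⟩ := symmetrization_surjective n y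
    have hsub : symmetrization n ⁻¹' interior (symmetrization n '' closedPolydisc n) ⊆
        interior (closedPolydisc n) :=
      interior_maximal
        (fun w hw => symmetrization_mem_image_closedPolydisc_iff.mp (interior_subset hw))
        (isOpen_interior.preimage (continuous_symmetrization n))
    rw [symmetrization_mem_image_polydisc_iff, ← interior_closedPolydisc]
    exact hsub hy
  · refine interior_maximal (Set.image_mono ?_) (isOpen_symmetrizedPolydisc n)
    exact fun z hz i => (hz i).le

theorem frontier_closedPolydisc (n : ℕ) :
    frontier (closedPolydisc n) = closedPolydisc n \ polydisc n := by
  rw [(isCompact_closedPolydisc n).isClosed.frontier_eq, interior_closedPolydisc]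

theorem frontier_image_closedPolydisc (n : ℕ) :
    frontier (symmetrization n '' closedPolydisc n) =
      (symmetrization n '' closedPolydisc n) \ symmetrizedPolydisc n := by
  rw [((isCompact_closedPolydisc n).image (continuous_symmetrization n)).isClosed.frontier_eq,
    interior_image_closedPolydisc]

/-! ### Distinguished boundaries -/

theorem differentiable_eval_update {n : ℕ} (p : MvPolynomial (Fin n) ℂ) (w : Fin n → ℂ)
    (a : Fin n) : Differentiable ℂ fun ζ => MvPolynomial.eval (Function.update w a ζ) p := by
  induction p using MvPolynomial.induction_on with
  | C r => simp
  | add p q hp hq => simp only [map_add]; exact hp.add hq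
  | mul_X p i hp =>
    simp only [map_mul, MvPolynomial.eval_X]
    refine hp.mul ?_
    rcases eq_or_ne i a with rfl | hia
    · simp
    · simp [hia]

/-- Maximum modulus principle on the polydisc, for rational functions. -/
theorem exists_mem_unitTorus_norm_le {n : ℕ} {p q : MvPolynomial (Fin n) ℂ}
    (hq : ∀ x ∈ closedPolydisc n, MvPolynomial.eval x q ≠ 0) {z : Fin n → ℂ}
    (hz : z ∈ closedPolydisc n) :
    ∃ w ∈ unitTorus n, ‖MvPolynomial.eval z p / MvPolynomial.eval z q‖ ≤
      ‖MvPolynomial.eval w p / MvPolynomial.eval w q‖ := by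
  -- Coordinates are pushed to the unit circle one at a time by the one-variable maximum principle.
  suffices h : ∀ s : Finset (Fin n), ∃ w ∈ closedPolydisc n, (∀ i ∈ s, ‖w i‖ = 1) ∧
      ‖MvPolynomial.eval z p / MvPolynomial.eval z q‖ ≤
      ‖MvPolynomial.eval w p / MvPolynomial.eval w q‖ by
    obtain ⟨w, -, hw, hle⟩ := h Finset.univ
    exact ⟨w, fun i => hw i (Finset.mem_univ i), hle⟩
  intro s
  induction s using Finset.induction_on with
  | empty => exact ⟨z, hz, by simp, le_rfl⟩
  | insert a s ha ih =>
    obtain ⟨w, hwc, hw, hle⟩ := ih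
    have hupd (ζ : ℂ) (hζ : ‖ζ‖ ≤ 1) : Function.update w a ζ ∈ closedPolydisc n := by
      intro i
      rcases eq_or_ne i a with rfl | hia
      · simpa using hζ
      · simpa [hia] using hwc i
    have hd : DiffContOnCl ℂ (fun ζ => MvPolynomial.eval (Function.update w a ζ) p /
        MvPolynomial.eval (Function.update w a ζ) q) (Metric.ball 0 1) := by
      refine DifferentiableOn.diffContOnCl fun ζ hζ => ?_
      rw [closure_ball _ one_ne_zero, mem_closedBall_zero_iff] at hζ
      exact ((differentiable_eval_update p w a ζ).div (differentiable_eval_update q w a ζ)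
        (hq _ (hupd ζ hζ))).differentiableWithinAt
    obtain ⟨ζ, hζ, hmax⟩ := Complex.exists_mem_frontier_isMaxOn_norm Metric.isBounded_ball
      (Metric.nonempty_ball.mpr one_pos) hd
    rw [frontier_ball _ one_ne_zero, mem_sphere_zero_iff_norm] at hζ
    refine ⟨Function.update w a ζ, hupd ζ hζ.le, fun i hi => ?_, hle.trans ?_⟩
    · rcases eq_or_ne i a with rfl | hia
      · simpa using hζ
      · simpa [hia] using hw i (Finset.mem_of_mem_insert_of_ne hi hia)
    · have h := hmax (a := w a) (by
        rw [closure_ball _ one_ne_zero, mem_closedBall_zero_iff]; exact hwc a)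
      simpa using h

theorem isRationalBoundary_unitTorus (n : ℕ) :
    IsRationalBoundary (closedPolydisc n) (unitTorus n) := by
  refine ⟨unitTorus_subset_closedPolydisc n, (isCompact_unitTorus n).isClosed, fun p q hq => ?_⟩
  have hc : ContinuousOn
      (fun x => ‖MvPolynomial.eval x p / MvPolynomial.eval x q‖) (unitTorus n) :=
    ((MvPolynomial.continuous_eval p).continuousOn.div (MvPolynomial.continuous_eval q).continuousOn
      fun x hx => hq x (unitTorus_subset_closedPolydisc n hx)).norm
  obtain ⟨t, ht, hmax⟩ := (isCompact_unitTorus n).exists_isMaxOn (unitTorus_nonempty n) hc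
  refine ⟨t, ht, fun y hy => ?_⟩
  obtain ⟨w, hw, hle⟩ := exists_mem_unitTorus_norm_le (p := p) hq hy
  exact hle.trans (hmax hw)

theorem isRationalBoundary_image_unitTorus (n : ℕ) :
    IsRationalBoundary (symmetrization n '' closedPolydisc n) (symmetrization n '' unitTorus n) := by
  refine ⟨Set.image_mono (unitTorus_subset_closedPolydisc n),
    ((isCompact_unitTorus n).image (continuous_symmetrization n)).isClosed, fun p q hq => ?_⟩
  obtain ⟨t, ht, hmax⟩ := (isRationalBoundary_unitTorus n).2.2
    (symmetrizationHom n p) (symmetrizationHom n q) fun x hx => by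
      rw [eval_symmetrizationHom]
      exact hq _ (Set.mem_image_of_mem _ hx)
  refine ⟨_, Set.mem_image_of_mem _ ht, ?_⟩
  rintro _ ⟨z, hz, rfl⟩
  simpa only [eval_symmetrizationHom] using hmax z hz

/-- A polynomial that peaks on the closed polydisc exactly at the point `t` of the torus. -/
noncomputable def peakPolynomial {n : ℕ} (t : Fin n → ℂ) : MvPolynomial (Fin n) ℂ :=
  ∏ i, (MvPolynomial.C (1 / 2) * (1 + MvPolynomial.C (starRingEnd ℂ (t i)) * MvPolynomial.X i))

theorem eval_peakPolynomial {n : ℕ} (t z : Fin n → ℂ) :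
    MvPolynomial.eval z (peakPolynomial t) = ∏ i, (1 / 2 * (1 + starRingEnd ℂ (t i) * z i)) := by
  simp [peakPolynomial]

theorem eval_peakPolynomial_self {n : ℕ} {t : Fin n → ℂ} (ht : t ∈ unitTorus n) :
    MvPolynomial.eval t (peakPolynomial t) = 1 := by
  rw [eval_peakPolynomial]
  refine Finset.prod_eq_one fun i _ => ?_
  rw [Complex.conj_mul', ht i]
  norm_num

theorem norm_half_one_add_le_one {u : ℂ} (hu : ‖u‖ ≤ 1) : ‖1 / 2 * (1 + u)‖ ≤ 1 := by
  rw [norm_mul]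
  have := norm_add_le 1 u
  rw [norm_one] at this
  norm_num
  linarith

theorem eq_one_of_one_le_norm_half_one_add {u : ℂ} (hu : ‖u‖ ≤ 1)
    (h : 1 ≤ ‖1 / 2 * (1 + u)‖) : u = 1 := by
  have h1 : u.re ^ 2 + u.im ^ 2 ≤ 1 := by
    have := Complex.sq_norm u
    rw [Complex.normSq_apply] at this
    nlinarith [norm_nonneg u]
  have h2 : 4 ≤ (1 + u.re) ^ 2 + u.im ^ 2 := by
    have h3 : 2 ≤ ‖1 + u‖ := by
      rw [norm_mul] at h
      norm_num at h
      linarith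
    have := Complex.sq_norm (1 + u)
    rw [Complex.normSq_apply] at this
    simp at this
    nlinarith
  have hre : u.re = 1 := by nlinarith [sq_nonneg (u.re - 1), sq_nonneg u.im]
  have him : u.im = 0 := by
    rw [hre] at h1
    exact pow_eq_zero_iff two_ne_zero |>.mp (by nlinarith [sq_nonneg u.im])
  exact Complex.ext hre him

theorem eq_of_one_le_norm_eval_peakPolynomial {n : ℕ} {t z : Fin n → ℂ} (ht : t ∈ unitTorus n)
    (hz : z ∈ closedPolydisc n) (h : 1 ≤ ‖MvPolynomial.eval z (peakPolynomial t)‖) : z = t := by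
  have hu (i : Fin n) : ‖starRingEnd ℂ (t i) * z i‖ ≤ 1 := by
    rw [norm_mul, RCLike.norm_conj, ht i, one_mul]
    exact hz i
  funext i
  have hi : starRingEnd ℂ (t i) * z i = 1 := by
    refine eq_one_of_one_le_norm_half_one_add (hu i) (h.trans ?_)
    rw [eval_peakPolynomial, norm_prod, ← Finset.mul_prod_erase _ _ (Finset.mem_univ i)]
    exact mul_le_of_le_one_right (norm_nonneg _)
      (Finset.prod_le_one (fun _ _ => norm_nonneg _) fun j _ => norm_half_one_add_le_one (hu j))
  have ht1 : starRingEnd ℂ (t i) * t i = 1 := by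
    rw [Complex.conj_mul', ht i]
    norm_num
  have hne : starRingEnd ℂ (t i) ≠ 0 := left_ne_zero_of_mul_eq_one ht1
  exact mul_left_cancel₀ hne (hi.trans ht1.symm)

theorem IsRationalBoundary.unitTorus_subset {n : ℕ} {Δ : Set (Fin n → ℂ)}
    (hΔ : IsRationalBoundary (closedPolydisc n) Δ) : unitTorus n ⊆ Δ := by
  intro t ht
  obtain ⟨x, hx, hmax⟩ := hΔ.2.2 (peakPolynomial t) 1 (by simp)
  have h := hmax t (unitTorus_subset_closedPolydisc n ht)
  simp only [map_one, div_one, eval_peakPolynomial_self ht, norm_one] at h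
  exact eq_of_one_le_norm_eval_peakPolynomial ht (hΔ.1 hx) h ▸ hx

theorem distinguishedBoundary_closedPolydisc (n : ℕ) :
    distinguishedBoundary (closedPolydisc n) = unitTorus n :=
  (Set.sInter_subset_of_mem (isRationalBoundary_unitTorus n)).antisymm
    (Set.subset_sInter fun _ hΔ => IsRationalBoundary.unitTorus_subset hΔ)

theorem isSymmetric_sum_rename {n : ℕ} (p : MvPolynomial (Fin n) ℂ) :
    (∑ σ : Equiv.Perm (Fin n), MvPolynomial.rename σ p).IsSymmetric := by
  intro τ
  rw [map_sum]
  simp only [MvPolynomial.rename_rename]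
  exact Fintype.sum_equiv (Equiv.mulLeft τ) _ _ fun σ => rfl

theorem comp_perm_mem_closedPolydisc {n : ℕ} {z : Fin n → ℂ} (hz : z ∈ closedPolydisc n)
    (σ : Equiv.Perm (Fin n)) : z ∘ σ ∈ closedPolydisc n :=
  fun i => hz (σ i)

open Filter Topology in
-- If `πₙ(t)` is not in `Δ`, a peak polynomial at `t` is bounded by some `c < 1` on the part `K` of
-- the closed polydisc over `Δ`. Summing its `k`-th powers over permutations gives symmetric
-- polynomials, which descend through `πₙ`. On `K` they are at most `n! * c ^ k`, yet at `t` they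
-- tend to the order of the stabilizer of `t`, which is not zero.
theorem IsRationalBoundary.image_unitTorus_subset {n : ℕ} {Δ : Set (Fin n → ℂ)}
    (hΔ : IsRationalBoundary (symmetrization n '' closedPolydisc n) Δ) :
    symmetrization n '' unitTorus n ⊆ Δ := by
  classical
  rintro _ ⟨t, ht, rfl⟩
  by_contra htΔ
  have htc := unitTorus_subset_closedPolydisc n ht
  let g : (Fin n → ℂ) → ℂ := fun z => MvPolynomial.eval z (peakPolynomial t)
  let F : ℕ → MvPolynomial (Fin n) ℂ := fun k =>
    ∑ σ : Equiv.Perm (Fin n), MvPolynomial.rename σ (peakPolynomial t ^ k)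
  have hF (k : ℕ) (z : Fin n → ℂ) :
      MvPolynomial.eval z (F k) = ∑ σ : Equiv.Perm (Fin n), g (z ∘ σ) ^ k := by
    simp only [F, g, map_sum, MvPolynomial.eval_rename, map_pow]
  have hlt (z : Fin n → ℂ) (hz : z ∈ closedPolydisc n) (hne : z ≠ t) : ‖g z‖ < 1 := by
    by_contra! h
    exact hne (eq_of_one_le_norm_eval_peakPolynomial ht hz h)
  let K := closedPolydisc n ∩ symmetrization n ⁻¹' Δ
  have hK : IsCompact K := (isCompact_closedPolydisc n).inter_right
    (hΔ.2.1.preimage (continuous_symmetrization n))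
  have hex (k : ℕ) : ∃ z ∈ K, ‖MvPolynomial.eval t (F k)‖ ≤ ‖MvPolynomial.eval z (F k)‖ := by
    obtain ⟨q, hq⟩ := exists_symmetrizationHom_eq (isSymmetric_sum_rename (peakPolynomial t ^ k))
    obtain ⟨x, hx, hmax⟩ := hΔ.2.2 q 1 (by simp)
    obtain ⟨z, hz, rfl⟩ := hΔ.1 hx
    refine ⟨z, ⟨hz, hx⟩, ?_⟩
    have h := hmax _ (Set.mem_image_of_mem _ htc)
    simpa only [map_one, div_one, ← eval_symmetrizationHom, hq] using h
  obtain ⟨c, hc0, hc1, hc⟩ : ∃ c : ℝ, 0 ≤ c ∧ c < 1 ∧ ∀ z ∈ K, ‖g z‖ ≤ c := by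
    -- Used only to see that `K` is nonempty.
    obtain ⟨z₀, hz₀, -⟩ := hex 0
    obtain ⟨z₁, hz₁, hmax⟩ := hK.exists_isMaxOn ⟨z₀, hz₀⟩
      (MvPolynomial.continuous_eval (peakPolynomial t)).norm.continuousOn
    refine ⟨‖g z₁‖, norm_nonneg _, hlt z₁ hz₁.1 ?_, fun z hz => hmax hz⟩
    rintro rfl
    exact htΔ hz₁.2
  have hupper (k : ℕ) :
      ‖MvPolynomial.eval t (F k)‖ ≤ Fintype.card (Equiv.Perm (Fin n)) * c ^ k := by
    obtain ⟨z, hz, hle⟩ := hex k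
    refine hle.trans ?_
    rw [hF]
    refine (norm_sum_le _ _).trans ?_
    rw [← nsmul_eq_mul]
    refine Finset.sum_le_card_nsmul _ _ _ fun σ _ => ?_
    rw [norm_pow]
    -- `K` is stable under permuting coordinates, so `c` also bounds `g (z ∘ σ)`.
    refine pow_le_pow_left₀ (norm_nonneg _) (hc _ ⟨comp_perm_mem_closedPolydisc hz.1 σ, ?_⟩) k
    rw [Set.mem_preimage, symmetrization_comp_perm]
    exact hz.2
  have hlim : Tendsto (fun k => MvPolynomial.eval t (F k)) atTop
      (𝓝 (∑ σ : Equiv.Perm (Fin n), if t ∘ σ = t then 1 else 0)) := by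
    simp only [hF]
    refine tendsto_finsetSum _ fun σ _ => ?_
    split_ifs with hσ
    · have hg : g (t ∘ σ) = 1 := by rw [hσ]; exact eval_peakPolynomial_self ht
      exact tendsto_const_nhds.congr fun k => by rw [hg, one_pow]
    · exact tendsto_pow_atTop_nhds_zero_of_norm_lt_one
        (hlt _ (comp_perm_mem_closedPolydisc htc σ) hσ)
  have hlim0 : Tendsto (fun k => MvPolynomial.eval t (F k)) atTop (𝓝 0) := by
    refine squeeze_zero_norm hupper ?_
    simpa using (tendsto_pow_atTop_nhds_zero_of_lt_one hc0 hc1).const_mul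
      (Fintype.card (Equiv.Perm (Fin n)) : ℝ)
  have h0 := tendsto_nhds_unique hlim hlim0
  rw [Finset.sum_boole, Nat.cast_eq_zero, Finset.card_eq_zero] at h0
  have h1 : (1 : Equiv.Perm (Fin n)) ∈
      Finset.univ.filter fun σ : Equiv.Perm (Fin n) => t ∘ σ = t := by simp
  rw [h0] at h1
  exact Finset.notMem_empty _ h1

theorem distinguishedBoundary_image_closedPolydisc (n : ℕ) :
    distinguishedBoundary (symmetrization n '' closedPolydisc n) =
      symmetrization n '' unitTorus n :=
  (Set.sInter_subset_of_mem (isRationalBoundary_image_unitTorus n)).antisymm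
    (Set.subset_sInter fun _ hΔ => IsRationalBoundary.image_unitTorus_subset hΔ)

/-! ### Transfer of the defining conditions through `πₙ` -/

theorem inter_symmetrizedPolydisc_image {n : ℕ} (W : Set (Fin n → ℂ)) :
    symmetrizedPolydisc n ∩ symmetrization n '' W = symmetrization n '' (polydisc n ∩ W) := by
  ext y
  constructor
  · rintro ⟨hy, z, hz, rfl⟩
    exact ⟨z, ⟨symmetrization_mem_image_polydisc_iff.mp hy, hz⟩, rfl⟩
  · rintro ⟨z, ⟨hz, hzW⟩, rfl⟩
    exact ⟨symmetrization_mem_image_polydisc_iff.mpr hz, z, hzW, rfl⟩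

/-- The boundary condition defining distinguished varieties holds for `W` in the polydisc if and
only if it holds for `πₙ(W)` in the symmetrized polydisc. -/
theorem boundary_condition_image_iff {n : ℕ} (W : Set (Fin n → ℂ)) :
    (symmetrization n '' W ∩ closure (symmetrizedPolydisc n)) ∩
        frontier (closure (symmetrizedPolydisc n)) =
      (symmetrization n '' W ∩ closure (symmetrizedPolydisc n)) ∩
        distinguishedBoundary (closure (symmetrizedPolydisc n)) ↔
    (W ∩ closure (polydisc n)) ∩ frontier (closure (polydisc n)) =
      (W ∩ closure (polydisc n)) ∩ distinguishedBoundary (closure (polydisc n)) := by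
  rw [closure_symmetrizedPolydisc, closure_polydisc, distinguishedBoundary_image_closedPolydisc,
    distinguishedBoundary_closedPolydisc, frontier_image_closedPolydisc, frontier_closedPolydisc,
    Set.ext_iff, Set.ext_iff]
  constructor
  · intro h z
    have hz := h (symmetrization n z)
    simp only [Set.mem_inter_iff, Set.mem_sdiff, symmetrization_mem_image_polydisc_iff,
      symmetrization_mem_image_closedPolydisc_iff,
      symmetrization_mem_image_unitTorus_iff] at hz ⊢
    have hW (hzW : z ∈ W) : symmetrization n z ∈ symmetrization n '' W :=
      Set.mem_image_of_mem _ hzW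
    tauto
  · intro h y
    simp only [Set.mem_inter_iff, and_assoc, and_congr_right_iff]
    rintro ⟨z, hz, rfl⟩
    have hz' := h z
    simp only [Set.mem_inter_iff, Set.mem_sdiff, symmetrization_mem_image_polydisc_iff,
      symmetrization_mem_image_closedPolydisc_iff,
      symmetrization_mem_image_unitTorus_iff] at hz' ⊢
    tauto

theorem theorem3p9 (n : ℕ) (hn : 1 ≤ n) (Λ : Set (Fin n → ℂ)) (hΛ : Λ ⊆ symmetrizedPolydisc n) :
    IsDistinguishedVariety (symmetrizedPolydisc n) Λ ↔
      ∃ Ω : Set (Fin n → ℂ),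
        IsDistinguishedVariety (polydisc n) Ω ∧ Λ = symmetrization n '' Ω := by
  constructor
  · rintro ⟨V, hV, hdim, rfl, hne, hbd⟩
    obtain ⟨W, hW, hWdim, rfl⟩ := hV.exists_image_symmetrization_eq hdim
    rw [inter_symmetrizedPolydisc_image] at hne ⊢
    exact ⟨_, ⟨W, hW, hWdim, rfl, Set.image_nonempty.mp hne,
      (boundary_condition_image_iff W).mp hbd⟩, rfl⟩
  · rintro ⟨_, ⟨W, hW, hWdim, rfl, hne, hbd⟩, rfl⟩
    obtain ⟨hV, hVdim⟩ := hW.image_symmetrization hWdim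
    exact ⟨_, hV, hVdim, (inter_symmetrizedPolydisc_image W).symm, hne.image _,
      (boundary_condition_image_iff W).mpr hbd⟩
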